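/- Let $p,q\ge 0$, $n=p+q$, and let $Cl_n$ be the real Clifford algebra of $\mathbb R^n$ with $v\cdot v=-|v|^2$, with anti-automorphism $\tau(x_1\cdots x_k)=x_k\cdots x_1$ for $x_i\in\mathbb R^n$. Let $M$ be a $p$-dimensional oriented Riemannian manifold and $E\to M$ an oriented vector bundle of rank $q$ with a fibre metric and a compatible connection; assume that $TM$ and $E$ are spin, with given spin structures $\tilde Q_M,\tilde Q_E$, and put $\tilde Q=\tilde Q_M\times_M\tilde Q_E$. Let $$\Sigma=\tilde Q\times_\rho Cl_n,\qquad U\Sigma=\tilde Q\times_\rho Spin(n)\subset\Sigma ,$$ where $\rho:Spin(p)\times Spin(q)\to Spin(n)\to GL(Cl_n)$ is left multiplication. Let $\nabla$ be the covariant derivative on $\Sigma$ induced by the Levi-Civita connection of $M$ and the connection of $E$, let $\cdot$ be the action of the Clifford bundle $Cl(TM\oplus E)$ on $\Sigma$, and for $\varphi,\varphi'\in\Sigma_x$ let $\langle\langle\varphi,\varphi'\rangle\rangle=\tau[\varphi']\,[\varphi]\in Cl_n$, where $[\varphi],[\varphi']$ are the components in any spinorial frame of $\tilde Q_x$. Let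 $$\mathcal Q_o=\{e_1\cdot e_2\cdots e_p\in Cl_n:\ e_1,\dots,e_p\in\mathbb R^n\ \text{orthonormal}\},$$ which is the Grassmannian of oriented $p$-dimensional subspaces of $\mathbb R^n$. Let $B:TM\times TM\to E$ be bilinear and symmetric, let $\varphi$ be a smooth section of $U\Sigma$ with $$\nabla_X\varphi=-\tfrac12\sum_{j=1}^p e_j\cdot B(X,e_j)\cdot\varphi\qquad (X\in TM),$$ where $(e_j)$ is an orthonormal basis of the tangent space, and let the immersion $F:M\to\mathbb R^n$ be given by $\varphi$, that is, $F$ is a smooth map with $dF(X)=\xi(X):=\langle\langle X\cdot\varphi,\varphi\rangle\rangle$ for all $X\in TM$. Then: 1. $F$ is an isometric immersion, and its Gauss map $G(x)=dF(e_1)\cdot dF(e_2)\cdots dF(e_p)$, where $(e_1,\dots,e_p)$ is a positively oriented orthonormal basis of $T_xM$, takes its values in $\mathcal Q_o$. 2. $\varphi$ is a lift of the Gauss map: with $\omega=e_1\cdots e_p\in Cl(T_xM)$ the volume element (the product of the vectors of a positively oriented orthonormal basis of $T_xM$), the map $\chi(\psi)=(x,\langle\langle\omega\cdot\psi,\psi\rangle\rangle)$,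 $\psi\in U\Sigma_x$, takes $U\Sigma$ into $M\times\mathcal Q_o$, and $\chi(\varphi(x))=(x,G(x))$ for all $x\in M$. 3. $\nabla'_X\psi:=\nabla_X\psi+\frac12\sum_{j=1}^p e_j\cdot B(X,e_j)\cdot\psi$ is a connection on the $Spin(n)$-bundle $U\Sigma$ (around every point $x$ there is a local spinorial frame in which $\nabla'$ at $x$ is $[\psi]\mapsto\partial_X[\psi]+A(X)[\psi]$ with $A(X)\in\Lambda^2\mathbb R^n\subset Cl_n$ linear in $X\in T_xM$), and $\varphi$ is parallel for it: $\nabla'\varphi=0$. -/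

import Mathlib

open Bundle CliffordAlgebra
open scoped Manifold ContDiff

noncomputable section

namespace SpinSubmanifold

/-! ### The Clifford algebra `Cl_n` and the group `Spin(n)` -/

/-- Euclidean space `ℝⁿ`. -/
abbrev Euc (n : ℕ) := EuclideanSpace ℝ (Fin n)

/-- The quadratic form `v ↦ -|v|²`, so that `v · w + w · v = -2 ⟨v, w⟩` in its Clifford algebra. -/
def negSq (V : Type*) [NormedAddCommGroup V] [InnerProductSpace ℝ V] : QuadraticForm ℝ V :=
  -(LinearMap.BilinMap.toQuadraticMap (innerₗ V))

theorem negSq_apply {V : Type*} [NormedAddCommGroup V] [InnerProductSpace ℝ V] (v : V) :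
    negSq V v = -(‖v‖ ^ 2) := by
  simp [negSq]

theorem polar_negSq {V : Type*} [NormedAddCommGroup V] [InnerProductSpace ℝ V] (v w : V) :
    QuadraticMap.polar (negSq V) v w = -2 * inner ℝ v w := by
  simp only [QuadraticMap.polar, negSq_apply, norm_add_sq_real]
  ring

theorem ι_mul_ι_of_inner_eq_zero {V : Type*} [NormedAddCommGroup V] [InnerProductSpace ℝ V]
    {v w : V} (h : inner ℝ v w = 0) :
    ι (negSq V) v * ι (negSq V) w = -(ι (negSq V) w * ι (negSq V) v) := by
  have := ι_mul_ι_add_swap (Q := negSq V) v w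
  rw [polar_negSq, h, mul_zero, map_zero] at this
  exact eq_neg_of_add_eq_zero_left this

/-- The isometry of quadratic spaces underlying a linear norm-preserving map. -/
def isom {V W : Type*} [NormedAddCommGroup V] [InnerProductSpace ℝ V]
    [NormedAddCommGroup W] [InnerProductSpace ℝ W] (f : V →ₗ[ℝ] W) (hf : ∀ v, ‖f v‖ = ‖v‖) :
    negSq V →qᵢ negSq W where
  toLinearMap := f
  map_app' v := by
    change negSq W (f v) = negSq V v
    rw [negSq_apply, negSq_apply, hf]

/-- The real Clifford algebra `Cl_n` of `ℝⁿ` with `v · v = -|v|²`. -/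
abbrev Cl (n : ℕ) := CliffordAlgebra (negSq (Euc n))

/-- The inclusion `ℝⁿ ⊂ Cl_n`. -/
abbrev vec (n : ℕ) : Euc n →ₗ[ℝ] Cl n := ι (negSq (Euc n))

/-- The group `Spin(n) ⊂ Cl_n`. -/
abbrev Spin (n : ℕ) := spinGroup (negSq (Euc n))

theorem vec_injective (n : ℕ) : Function.Injective (vec n) := by
  have h : ∀ v, equivExterior (negSq (Euc n)) (vec n v) = ExteriorAlgebra.ι ℝ v := fun v => by
    simp [changeFormEquiv, changeForm_ι]
  intro v w hvw
  have := congrArg (equivExterior (negSq (Euc n))) hvw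
  rw [h, h] at this
  exact ExteriorAlgebra.ι_leftInverse.injective this

/-- `Λ²ℝⁿ ⊂ Cl_n`, the Lie algebra of `Spin(n)`. -/
def spinLie (n : ℕ) : Submodule ℝ (Cl n) :=
  Submodule.span ℝ {a | ∃ v w : Euc n, inner ℝ v w = 0 ∧ a = vec n v * vec n w}

instance finite_exterior (n : ℕ) : Module.Finite ℝ (ExteriorAlgebra ℝ (Euc n)) := by
  have h0 : ∀ i, n < i → (⋀[ℝ]^i (Euc n)) = ⊥ := fun i hi => by
    have : Module.finrank ℝ (⋀[ℝ]^i (Euc n)) = 0 := by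
      rw [exteriorPower.finrank_eq, finrank_euclideanSpace_fin]
      exact Nat.choose_eq_zero_of_lt hi
    exact Submodule.finrank_eq_zero.mp this
  have htop := (DirectSum.Decomposition.isInternal
    (fun i : ℕ => ⋀[ℝ]^i (Euc n))).submodule_iSup_eq_top
  have h1 : (⨆ i ∈ Finset.range (n + 1), (⋀[ℝ]^i (Euc n))) =
      (⊤ : Submodule ℝ (ExteriorAlgebra ℝ (Euc n))) := by
    rw [eq_top_iff, ← htop]
    refine iSup_le fun i => ?_
    by_cases hi : i ∈ Finset.range (n + 1)
    · exact le_iSup₂_of_le i hi le_rfl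
    · rw [h0 i (by simpa using hi)]
      exact bot_le
  refine ⟨?_⟩
  rw [← h1]
  exact Submodule.fg_biSup _ _ fun i _ => Module.Finite.iff_fg.mp inferInstance

instance finite_Cl (n : ℕ) : Module.Finite ℝ (Cl n) :=
  Module.Finite.equiv (equivExterior (negSq (Euc n))).symm

/-- A norm on the finite-dimensional vector space `Cl_n` (all of them are equivalent); it only
serves to speak of continuous and of smooth functions with values in `Cl_n`. -/
instance normedCl (n : ℕ) : NormedAddCommGroup (Cl n) :=
  NormedAddCommGroup.induced (Cl n) (Fin (Module.finrank ℝ (Cl n)) → ℝ)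
    (Module.finBasis ℝ (Cl n)).equivFun (Module.finBasis ℝ (Cl n)).equivFun.injective

instance normedSpaceCl (n : ℕ) : NormedSpace ℝ (Cl n) :=
  NormedSpace.induced ℝ (Cl n) (Fin (Module.finrank ℝ (Cl n)) → ℝ)
    (Module.finBasis ℝ (Cl n)).equivFun

/-! ### The map `Spin(p) × Spin(q) → Spin(p + q)` -/

/-- The inclusion `ℝᵖ → ℝᵖ ⊕ ℝ^q = ℝ^(p+q)`. -/
def inlEuc (p q : ℕ) : Euc p →ₗ[ℝ] Euc (p + q) where
  toFun v := WithLp.toLp 2 (Fin.append v.ofLp 0)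
  map_add' v w := by
    ext i
    refine Fin.addCases (fun i => ?_) (fun i => ?_) i <;> simp
  map_smul' c v := by
    ext i
    refine Fin.addCases (fun i => ?_) (fun i => ?_) i <;> simp

/-- The inclusion `ℝ^q → ℝᵖ ⊕ ℝ^q = ℝ^(p+q)`. -/
def inrEuc (p q : ℕ) : Euc q →ₗ[ℝ] Euc (p + q) where
  toFun v := WithLp.toLp 2 (Fin.append 0 v.ofLp)
  map_add' v w := by
    ext i
    refine Fin.addCases (fun i => ?_) (fun i => ?_) i <;> simp
  map_smul' c v := by
    ext i
    refine Fin.addCases (fun i => ?_) (fun i => ?_) i <;> simp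

theorem norm_inlEuc {p q : ℕ} (v : Euc p) : ‖inlEuc p q v‖ = ‖v‖ := by
  simp [EuclideanSpace.norm_eq, inlEuc, Fin.sum_univ_add]

theorem norm_inrEuc {p q : ℕ} (v : Euc q) : ‖inrEuc p q v‖ = ‖v‖ := by
  simp [EuclideanSpace.norm_eq, inrEuc, Fin.sum_univ_add]

theorem inner_inl_inr {p q : ℕ} (v : Euc p) (w : Euc q) :
    inner ℝ (inlEuc p q v) (inrEuc p q w) = 0 := by
  simp [PiLp.inner_apply, inlEuc, inrEuc, Fin.sum_univ_add]

/-- `Cl_p → Cl_(p+q)`. -/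
def clInl (p q : ℕ) : Cl p →ₐ[ℝ] Cl (p + q) := map (isom (inlEuc p q) norm_inlEuc)

/-- `Cl_q → Cl_(p+q)`. -/
def clInr (p q : ℕ) : Cl q →ₐ[ℝ] Cl (p + q) := map (isom (inrEuc p q) norm_inrEuc)

theorem clInl_vec {p q : ℕ} (v : Euc p) : clInl p q (vec p v) = vec (p + q) (inlEuc p q v) :=
  map_apply_ι _ _

theorem clInr_vec {p q : ℕ} (v : Euc q) : clInr p q (vec q v) = vec (p + q) (inrEuc p q v) :=
  map_apply_ι _ _

/-- The product `g h ∈ Cl_(p+q)` of `g ∈ Spin(p)` and `h ∈ Spin(q)`, i.e. the natural map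
`Spin(p) × Spin(q) → Spin(p+q)`. -/
def spinMul {p q : ℕ} (g : Spin p) (h : Spin q) : Cl (p + q) :=
  clInl p q (g : Cl p) * clInr p q (h : Cl q)

theorem isOrtho_inl_inr {p q : ℕ} (v : Euc p) (w : Euc q) :
    (negSq (Euc (p + q))).IsOrtho (isom (inlEuc p q) norm_inlEuc v)
      (isom (inrEuc p q) norm_inrEuc w) := by
  have h : QuadraticMap.polar (negSq (Euc (p + q))) (inlEuc p q v) (inrEuc p q w) = 0 := by
    rw [polar_negSq, inner_inl_inr, mul_zero]
  change negSq (Euc (p + q)) (inlEuc p q v + inrEuc p q w) =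
    negSq (Euc (p + q)) (inlEuc p q v) + negSq (Euc (p + q)) (inrEuc p q w)
  rw [QuadraticMap.polar] at h
  linarith

theorem commute_clInl_vec {p q : ℕ} (g : Spin p) (w : Euc q) :
    Commute (clInl p q (g : Cl p)) (vec (p + q) (inrEuc p q w)) := by
  rw [← clInr_vec]
  exact commute_map_mul_map_of_isOrtho_of_mem_evenOdd_zero_left _ _ isOrtho_inl_inr _ _
    (spinGroup.mem_even g.2) (ι_mem_evenOdd_one _ w)

theorem commute_clInr_vec {p q : ℕ} (v : Euc p) (h : Spin q) :
    Commute (vec (p + q) (inlEuc p q v)) (clInr p q (h : Cl q)) := by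
  rw [← clInl_vec]
  exact commute_map_mul_map_of_isOrtho_of_mem_evenOdd_zero_right _ _ isOrtho_inl_inr _ _
    (ι_mem_evenOdd_one _ v) (spinGroup.mem_even h.2)

theorem commute_clInl_clInr {p q : ℕ} (g : Spin p) (h : Spin q) :
    Commute (clInl p q (g : Cl p)) (clInr p q (h : Cl q)) :=
  commute_map_mul_map_of_isOrtho_of_mem_evenOdd_zero_left _ _ isOrtho_inl_inr _ _
    (spinGroup.mem_even g.2) (spinGroup.mem_even h.2)

theorem spinMul_mul {p q : ℕ} (g g' : Spin p) (h h' : Spin q) :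
    spinMul (g * g') (h * h') = spinMul g h * spinMul g' h' := by
  simp only [spinMul, Submonoid.coe_mul, map_mul]
  rw [mul_assoc, mul_assoc, ← mul_assoc (clInl p q (g' : Cl p)),
    (commute_clInl_clInr g' h).eq, mul_assoc]

theorem reverse_map {V W : Type*} [AddCommGroup V] [Module ℝ V] [AddCommGroup W] [Module ℝ W]
    {Q : QuadraticForm ℝ V} {Q' : QuadraticForm ℝ W} (f : Q →qᵢ Q') (a : CliffordAlgebra Q) :
    reverse (map f a) = map f (reverse a) := by
  induction a using CliffordAlgebra.induction with
  | algebraMap r => simp [reverse.commutes]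
  | ι v => simp
  | mul a b ha hb => simp [reverse.map_mul, ha, hb]
  | add a b ha hb => simp [ha, hb]

theorem reverse_mul_self_of_spin {n : ℕ} {g : Cl n} (hg : g ∈ Spin n) : reverse g * g = 1 := by
  have := spinGroup.star_mul_self_of_mem hg
  rwa [star_def, spinGroup.involute_eq hg] at this

theorem self_mul_reverse_of_spin {n : ℕ} {g : Cl n} (hg : g ∈ Spin n) : g * reverse g = 1 := by
  have := spinGroup.mul_star_self_of_mem hg
  rwa [star_def, spinGroup.involute_eq hg] at this

theorem reverse_spinMul_mul {p q : ℕ} (g : Spin p) (h : Spin q) :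
    reverse (spinMul g h) * spinMul g h = 1 := by
  rw [spinMul, reverse.map_mul, clInl, clInr, reverse_map, reverse_map, mul_assoc,
    ← mul_assoc (map _ (reverse (g : Cl p))), ← map_mul, reverse_mul_self_of_spin g.2, map_one,
    one_mul, ← map_mul, reverse_mul_self_of_spin h.2, map_one]

theorem spinMul_mul_reverse {p q : ℕ} (g : Spin p) (h : Spin q) :
    spinMul g h * reverse (spinMul g h) = 1 := by
  rw [spinMul, reverse.map_mul, clInl, clInr, reverse_map, reverse_map, mul_assoc,
    ← mul_assoc (map _ (h : Cl q)), ← map_mul, self_mul_reverse_of_spin h.2, map_one,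
    one_mul, ← map_mul, self_mul_reverse_of_spin g.2, map_one]

/-! ### Products of orthonormal vectors -/

/-- The product `v 0 · v 1 ⋯ v (k-1)` of `k` vectors in the Clifford algebra. -/
def cliffProd {V : Type*} [NormedAddCommGroup V] [InnerProductSpace ℝ V] {k : ℕ}
    (v : Fin k → V) : CliffordAlgebra (negSq V) :=
  (List.ofFn fun i => ι (negSq V) (v i)).prod

/-- The Grassmannian `𝒬_o ⊂ Cl_n` of oriented `p`-dimensional subspaces of `ℝⁿ`:
the products of `p` orthonormal vectors. -/
def orientedGrassmannian (p n : ℕ) : Set (Cl n) :=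
  {a | ∃ e : Fin p → Euc n, Orthonormal ℝ e ∧ a = cliffProd e}


theorem contractLeft_prod_eq_zero {V : Type*} [AddCommGroup V] [Module ℝ V]
    {Q : QuadraticForm ℝ V} (d : Module.Dual ℝ V) (l : List V) (hl : ∀ v ∈ l, d v = 0) :
    contractLeft d (l.map (ι Q)).prod = 0 := by
  induction l with
  | nil => simp
  | cons v l ih =>
    rw [List.map_cons, List.prod_cons, contractLeft_ι_mul, hl v (by simp),
      ih fun w hw => hl w (by simp [hw])]
    simp

theorem equivExterior_prod {V : Type*} [NormedAddCommGroup V] [InnerProductSpace ℝ V]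
    (l : List V) (hl : l.Pairwise fun v w => inner ℝ v w = 0) :
    equivExterior (negSq V) (l.map (ι (negSq V))).prod = (l.map (ExteriorAlgebra.ι ℝ)).prod := by
  induction l with
  | nil => simp [changeFormEquiv, changeForm_one]
  | cons v l ih =>
    rw [List.pairwise_cons] at hl
    have ih := ih hl.2
    rw [equivExterior, changeFormEquiv_apply] at ih ⊢
    rw [List.map_cons, List.prod_cons, changeForm_ι_mul, ih, List.map_cons, List.prod_cons]
    refine sub_eq_self.mpr (contractLeft_prod_eq_zero _ l fun w hw => ?_)
    have h := hl.1 w hw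
    simp [QuadraticMap.associated_apply, negSq_apply, norm_add_sq_real, h]

theorem equivExterior_cliffProd {V : Type*} [NormedAddCommGroup V] [InnerProductSpace ℝ V]
    {k : ℕ} {v : Fin k → V} (hv : Orthonormal ℝ v) :
    equivExterior (negSq V) (cliffProd v) = ExteriorAlgebra.ιMulti ℝ k v := by
  have h : (List.ofFn v).Pairwise fun v w => inner ℝ v w = 0 := by
    rw [List.pairwise_ofFn]
    exact fun i j hij => hv.2 hij.ne
  have := equivExterior_prod (List.ofFn v) h
  rw [List.map_ofFn, List.map_ofFn] at this
  rw [ExteriorAlgebra.ιMulti_apply]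
  exact this

/-- The Clifford product of the vectors of an orthonormal basis depends on the orientation of
the basis only. -/
theorem cliffProd_eq_of_orientation_eq {V : Type*} [NormedAddCommGroup V]
    [InnerProductSpace ℝ V] {k : ℕ} (e f : OrthonormalBasis (Fin k) ℝ V)
    (h : e.toBasis.orientation = f.toBasis.orientation) :
    cliffProd e = cliffProd f := by
  apply (equivExterior (negSq V)).injective
  rw [equivExterior_cliffProd e.orthonormal, equivExterior_cliffProd f.orthonormal]
  have key : ExteriorAlgebra.ιMulti ℝ k (M := V) =
      (LinearMap.toSpanSingleton ℝ _ (ExteriorAlgebra.ιMulti ℝ k f)).compAlternatingMap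
        f.toBasis.det := by
    refine Module.Basis.ext_alternating f.toBasis fun i hi => ?_
    let σ : Equiv.Perm (Fin k) := Equiv.ofBijective i (Finite.injective_iff_bijective.1 hi)
    change ExteriorAlgebra.ιMulti ℝ k (f.toBasis ∘ σ) =
      f.toBasis.det (f.toBasis ∘ σ) • ExteriorAlgebra.ιMulti ℝ k f
    rw [AlternatingMap.map_perm, AlternatingMap.map_perm, Module.Basis.det_self]
    simp
  have := congrArg (fun A => A e) key
  simp only [LinearMap.compAlternatingMap_apply, LinearMap.toSpanSingleton_apply] at this
  rw [this, f.det_to_matrix_orthonormalBasis_of_same_orientation e h.symm, one_smul]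

/-- The trace of a bilinear map does not depend on the orthonormal basis. -/
theorem sum_bilin_eq {V W : Type*} [NormedAddCommGroup V] [InnerProductSpace ℝ V]
    [AddCommGroup W] [Module ℝ W] {k : ℕ} (b : V →ₗ[ℝ] V →ₗ[ℝ] W)
    (e f : OrthonormalBasis (Fin k) ℝ V) : ∑ j, b (e j) (e j) = ∑ j, b (f j) (f j) := by
  have h : ∀ j, e j = ∑ i, inner ℝ (f i) (e j) • f i := fun j => (f.sum_repr' (e j)).symm
  calc ∑ j, b (e j) (e j)
      = ∑ j, ∑ i, ∑ l, (inner ℝ (f i) (e j) * inner ℝ (e j) (f l)) • b (f i) (f l) := by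
        refine Finset.sum_congr rfl fun j _ => ?_
        conv_lhs => rw [h j]
        simp only [map_sum, map_smul, LinearMap.sum_apply, LinearMap.smul_apply,
          Finset.smul_sum, smul_smul]
        rw [Finset.sum_comm]
        refine Finset.sum_congr rfl fun i _ => Finset.sum_congr rfl fun l _ => ?_
        rw [real_inner_comm (f l) (e j)]
        congr 1
        ring
    _ = ∑ i, ∑ l, (∑ j, inner ℝ (f i) (e j) * inner ℝ (e j) (f l)) • b (f i) (f l) := by
        rw [Finset.sum_comm]
        refine Finset.sum_congr rfl fun i _ => ?_
        rw [Finset.sum_comm]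
        simp only [Finset.sum_smul]
    _ = ∑ j, b (f j) (f j) := by
        simp only [e.sum_inner_mul_inner, f.inner_eq_ite, ite_smul, one_smul, zero_smul,
          Finset.sum_ite_eq, Finset.mem_univ, if_true]

/-! ### Oriented Riemannian vector bundles and spin structures -/

section Bundle

variable {B : Type*} [NormedAddCommGroup B] [NormedSpace ℝ B] {H : Type*} [TopologicalSpace H]
  (I : ModelWithCorners ℝ B H) {M : Type*} [TopologicalSpace M] [ChartedSpace H M]
  (F : Type*) [NormedAddCommGroup F] [NormedSpace ℝ F]
  (V : M → Type*) [TopologicalSpace (TotalSpace F V)] [∀ x, NormedAddCommGroup (V x)]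
  [∀ x, InnerProductSpace ℝ (V x)] [FiberBundle F V] (k : ℕ)

/-- An orientation of a Riemannian vector bundle `V → M` of rank `k`: an orientation of each fibre
such that near every point there is a smooth, positively oriented orthonormal frame. -/
structure BundleOrientation where
  /-- the orientation of the fibres -/
  or : ∀ x, Orientation ℝ (V x) (Fin k)
  exists_frame : ∀ x₀, ∃ U : Set M, IsOpen U ∧ x₀ ∈ U ∧
    ∃ e : ∀ x, Fin k → V x,
      (∀ i, ContMDiffOn I (I.prod 𝓘(ℝ, F)) ∞ (fun x => TotalSpace.mk' F x (e x i)) U) ∧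
      ∀ x ∈ U, ∃ b : OrthonormalBasis (Fin k) ℝ (V x),
        b.toBasis.orientation = or x ∧ ∀ i, b i = e x i

variable {I F V k}

/-- The positively oriented orthonormal frames of the fibre `V x`: the fibre at `x` of the frame
bundle `Q_V`. -/
abbrev PosFrame (o : BundleOrientation I F V k) (x : M) :=
  {b : OrthonormalBasis (Fin k) ℝ (V x) // b.toBasis.orientation = o.or x}

instance posFrame_nonempty (o : BundleOrientation I F V k) (x : M) : Nonempty (PosFrame o x) := by
  obtain ⟨U, -, hx, e, -, he⟩ := o.exists_frame x
  obtain ⟨b, hb, -⟩ := he x hx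
  exact ⟨⟨b, hb⟩⟩

/-- Some positively oriented orthonormal basis of `V x`. -/
def somePosFrame (o : BundleOrientation I F V k) (x : M) : OrthonormalBasis (Fin k) ℝ (V x) :=
  (Classical.arbitrary (PosFrame o x)).1

/-- A spin structure on the oriented Riemannian bundle `V` of rank `k`: a principal
`Spin(k)`-bundle `Q̃ → M` (with fibres `P x`, a right action of `Spin(k)` on the fibres and a
topology on the total space), with a map `Q̃ → Q_V` to the bundle of positively oriented orthonormal
frames of `V` which is equivariant for `Ad : Spin(k) → SO(k)`. A frame `b` is thought of as the
isometry `u_b : ℝᵏ → V x`, `v ↦ ∑ v i • b i` (`b.repr.symm` below), and equivariance reads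
`u_{s·g} = u_s ∘ Ad(g)`, where `Ad(g) v = g v g⁻¹`. Local triviality: near every point there is a
local section which trivializes `Q̃` and whose underlying frame is smooth. -/
structure SpinStructure (o : BundleOrientation I F V k) where
  /-- the fibres of `Q̃` -/
  P : M → Type*
  /-- the topology of the total space of `Q̃` -/
  top : TopologicalSpace (TotalSpace (Spin k) P)
  /-- the right action of `Spin(k)` -/
  act : ∀ {x}, P x → Spin k → P x
  act_one : ∀ {x} (s : P x), act s 1 = s
  act_mul : ∀ {x} (s : P x) (g h : Spin k), act s (g * h) = act (act s g) h
  simply_transitive : ∀ {x} (s s' : P x), ∃! g : Spin k, act s g = s'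
  /-- the map to the frame bundle -/
  frame : ∀ {x}, P x → PosFrame o x
  frame_act : ∀ {x} (s : P x) (g : Spin k) (v w : Euc k),
    vec k w = g * vec k v * (g⁻¹ : Spin k) →
      (frame (act s g)).1.repr.symm v = (frame s).1.repr.symm w
  locally_trivial : ∀ x₀, ∃ U : Set M, IsOpen U ∧ x₀ ∈ U ∧ ∃ s : ∀ x, P x,
    (∀ i, ContMDiffOn I (I.prod 𝓘(ℝ, F)) ∞
      (fun x => TotalSpace.mk' F x ((frame (s x)).1 i)) U) ∧
    Topology.IsOpenEmbedding (fun y : U × Spin k => TotalSpace.mk' (Spin k) y.1.1 (act (s y.1) y.2))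

namespace SpinStructure

variable {o : BundleOrientation I F V k} (S : SpinStructure o)

/-- `s` is a smooth section of `Q̃` over `U`: it is continuous and the frame below it is smooth.
(The values of `s` outside `U` are irrelevant.) -/
def IsSection (U : Set M) (s : ∀ x, S.P x) : Prop :=
  letI := S.top
  ContinuousOn (fun x => TotalSpace.mk' (Spin k) x (s x)) U ∧
  ∀ i, ContMDiffOn I (I.prod 𝓘(ℝ, F)) ∞ (fun x => TotalSpace.mk' F x ((S.frame (s x)).1 i)) U

theorem exists_section (x₀ : M) :
    ∃ U : Set M, IsOpen U ∧ x₀ ∈ U ∧ ∃ s : ∀ x, S.P x, S.IsSection U s := by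
  let _ := S.top
  obtain ⟨U, hU, hx, s, hs, he⟩ := S.locally_trivial x₀
  refine ⟨U, hU, hx, s, ?_, hs⟩
  rw [continuousOn_iff_continuous_domRestrict]
  have h := he.continuous.comp (Continuous.prodMk_left (X := U) (1 : Spin k))
  refine h.congr fun y => ?_
  simp [S.act_one]

/-- A smooth local section of `Q̃` near `x`. -/
def localSection (x : M) : ∀ y, S.P y :=
  (S.exists_section x).choose_spec.2.2.choose

/-- The domain of `S.localSection x`. -/
def localDomain (x : M) : Set M := (S.exists_section x).choose

theorem isOpen_localDomain (x : M) : IsOpen (S.localDomain x) :=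
  (S.exists_section x).choose_spec.1

theorem mem_localDomain (x : M) : x ∈ S.localDomain x :=
  (S.exists_section x).choose_spec.2.1

theorem isSection_localSection (x : M) : S.IsSection (S.localDomain x) (S.localSection x) :=
  (S.exists_section x).choose_spec.2.2.choose_spec

/-- The local form `s^*α` of the spinorial connection on `Q̃` induced by a connection `cov` on `V`,
in the section `s` of `Q̃` above the frame `(e_1, …, e_k)`:
`X ↦ ½ ∑_{i < j} ⟨∇_X e_i, e_j⟩ ε_i · ε_j ∈ Λ²ℝᵏ ⊂ Cl_k`, where `ε` is the canonical basis. -/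
def connForm (cov : CovariantDerivative I F V) (s : ∀ x, S.P x) (x : M) (X : TangentSpace I x) :
    Cl k :=
  (1 / 2 : ℝ) • ∑ i : Fin k, ∑ j ∈ Finset.Ioi i,
    (inner ℝ (cov (fun y => (S.frame (s y)).1 i) x X) ((S.frame (s x)).1 j) : ℝ) •
      (vec k (EuclideanSpace.single i 1) * vec k (EuclideanSpace.single j 1))

instance (x : M) : Nonempty (S.P x) := by
  obtain ⟨U, -, -, s, -⟩ := S.exists_section x
  exact ⟨s x⟩

theorem vec_repr_act {x : M} (s : S.P x) (g : Spin k) (z : V x) :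
    (g : Cl k) * vec k ((S.frame (S.act s g)).1.repr z) =
      vec k ((S.frame s).1.repr z) * (g : Cl k) := by
  set v := (S.frame (S.act s g)).1.repr z with hv
  obtain ⟨w, hw⟩ : ∃ w, vec k w = g * vec k v * (g⁻¹ : Spin k) := by
    have := spinGroup.conjAct_smul_ι_mem_range_ι (x := spinGroup.toUnits g) g.2 v
    obtain ⟨w, hw⟩ := this
    exact ⟨w, hw⟩
  have h := S.frame_act s g v w hw
  rw [hv, LinearIsometryEquiv.symm_apply_apply] at h
  have h2 : (S.frame s).1.repr z = w := by
    rw [h, LinearIsometryEquiv.apply_symm_apply]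
  rw [h2, hw, mul_assoc, ← Submonoid.coe_mul, inv_mul_cancel, Submonoid.coe_one, mul_one]

end SpinStructure

end Bundle

/-! ### The bundle `Σ` associated with the spin structures of two bundles `V` and `W` -/

section Sigma

variable {B : Type*} [NormedAddCommGroup B] [NormedSpace ℝ B] {H : Type*} [TopologicalSpace H]
  {I : ModelWithCorners ℝ B H} {M : Type*} [TopologicalSpace M] [ChartedSpace H M]
  {F : Type*} [NormedAddCommGroup F] [NormedSpace ℝ F]
  {V : M → Type*} [TopologicalSpace (TotalSpace F V)] [∀ x, NormedAddCommGroup (V x)]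
  [∀ x, InnerProductSpace ℝ (V x)] [FiberBundle F V] {p : ℕ}
  {G : Type*} [NormedAddCommGroup G] [NormedSpace ℝ G]
  {W : M → Type*} [TopologicalSpace (TotalSpace G W)] [∀ x, NormedAddCommGroup (W x)]
  [∀ x, InnerProductSpace ℝ (W x)] [FiberBundle G W] {q : ℕ}
  {o : BundleOrientation I F V p} {o' : BundleOrientation I G W q}
  (S : SpinStructure o) (T : SpinStructure o')

/-- The fibre at `x` of `Q̃ = Q̃_V ×_M Q̃_W`. -/
abbrev SpinFrame (x : M) := S.P x × T.P x

/-- The fibre at `x` of the associated bundle `Σ = Q̃ ×_ρ Cl_(p+q)`, where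
`ρ : Spin(p) × Spin(q) → GL(Cl_(p+q))` is left multiplication: an element `φ` of `Σ_x` is given by
its components `φ s = [φ] ∈ Cl_(p+q)` in the spinorial frames `s ∈ Q̃_x`, subject to
`φ (s · (g, h)) = ρ(g, h)⁻¹ (φ s)`. -/
def SpinorFiber (x : M) : Submodule ℝ (SpinFrame S T x → Cl (p + q)) where
  carrier := {f | ∀ (s : SpinFrame S T x) (g : Spin p) (h : Spin q),
    spinMul g h * f (S.act s.1 g, T.act s.2 h) = f s}
  add_mem' ha hb s g h := by simp only [Pi.add_apply, mul_add, ha s g h, hb s g h]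
  zero_mem' s g h := by simp
  smul_mem' c a ha s g h := by simp only [Pi.smul_apply, mul_smul_comm, ha s g h]

/-- The element of `Σ_x` with component `a` in the spinorial frame `s`. -/
def spinorOfFrame {x : M} (s : SpinFrame S T x) (a : Cl (p + q)) : SpinorFiber S T x :=
  ⟨fun r => reverse (spinMul (S.simply_transitive s.1 r.1).choose
      (T.simply_transitive s.2 r.2).choose) * a, by
    intro r g h
    have h1 : (S.simply_transitive s.1 (S.act r.1 g)).choose =
        (S.simply_transitive s.1 r.1).choose * g := by
      refine (S.simply_transitive s.1 (S.act r.1 g)).unique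
        (S.simply_transitive s.1 (S.act r.1 g)).choose_spec.1 ?_
      rw [S.act_mul, (S.simply_transitive s.1 r.1).choose_spec.1]
    have h2 : (T.simply_transitive s.2 (T.act r.2 h)).choose =
        (T.simply_transitive s.2 r.2).choose * h := by
      refine (T.simply_transitive s.2 (T.act r.2 h)).unique
        (T.simply_transitive s.2 (T.act r.2 h)).choose_spec.1 ?_
      rw [T.act_mul, (T.simply_transitive s.2 r.2).choose_spec.1]
    simp only [h1, h2]
    rw [spinMul_mul, reverse.map_mul, mul_assoc, ← mul_assoc (spinMul g h),
      spinMul_mul_reverse, one_mul]⟩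

theorem spinorOfFrame_apply {x : M} (s : SpinFrame S T x) (a : Cl (p + q)) :
    (spinorOfFrame S T s a).1 s = a := by
  have h1 : (S.simply_transitive s.1 s.1).choose = 1 :=
    (S.simply_transitive s.1 s.1).unique
      (S.simply_transitive s.1 s.1).choose_spec.1 (S.act_one _)
  have h2 : (T.simply_transitive s.2 s.2).choose = 1 :=
    (T.simply_transitive s.2 s.2).unique
      (T.simply_transitive s.2 s.2).choose_spec.1 (T.act_one _)
  change reverse (spinMul _ _) * a = a
  rw [h1, h2]
  simp [spinMul, reverse.map_one]

/-- The fibre at `x` of `UΣ = Q̃ ×_ρ Spin(p+q) ⊂ Σ`. -/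
def USigma (x : M) : Set (SpinorFiber S T x) :=
  {φ | ∀ s, φ.1 s ∈ Spin (p + q)}

/-- Smooth sections of `Σ`: the components in smooth spinorial frames are smooth. -/
def IsSmoothSection (φ : ∀ x, SpinorFiber S T x) : Prop :=
  ∀ (U : Set M) (s : ∀ x, S.P x) (t : ∀ x, T.P x), IsOpen U → S.IsSection U s → T.IsSection U t →
    ContMDiffOn I 𝓘(ℝ, Cl (p + q)) ∞ (fun x => (φ x).1 (s x, t x)) U

/-- The `Cl_(p+q)`-valued pairing `⟪⟪φ, φ'⟫⟫ = τ[φ'] [φ]`, computed in some spinorial frame. -/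
def pairing {x : M} (φ φ' : SpinorFiber S T x) : Cl (p + q) :=
  reverse (φ'.1 (Classical.arbitrary _)) * φ.1 (Classical.arbitrary _)

/-- The pairing can be computed in any spinorial frame. -/
theorem pairing_eq {x : M} (φ φ' : SpinorFiber S T x) (s : SpinFrame S T x) :
    pairing S T φ φ' = reverse (φ'.1 s) * φ.1 s := by
  unfold pairing
  set r : SpinFrame S T x := Classical.arbitrary _
  obtain ⟨g, hg, -⟩ := S.simply_transitive s.1 r.1
  obtain ⟨h, hh, -⟩ := T.simply_transitive s.2 r.2
  have hr : (S.act s.1 g, T.act s.2 h) = r := Prod.ext hg hh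
  have h1 := φ.2 s g h
  have h2 := φ'.2 s g h
  rw [hr] at h1 h2
  rw [← h1, ← h2, reverse.map_mul, mul_assoc, ← mul_assoc _ (spinMul g h),
    reverse_spinMul_mul, one_mul]

/-! ### The action of the Clifford bundle -/

/-- The coordinates `V x ⊕ W x → ℝ^(p+q)` in the frame below a spinorial frame. -/
def coords {x : M} (s : SpinFrame S T x) : WithLp 2 (V x × W x) →ₗ[ℝ] Euc (p + q) :=
  inlEuc p q ∘ₗ (S.frame s.1).1.repr.toLinearEquiv.toLinearMap ∘ₗ WithLp.fstₗ 2 ℝ (V x) (W x) +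
  inrEuc p q ∘ₗ (T.frame s.2).1.repr.toLinearEquiv.toLinearMap ∘ₗ WithLp.sndₗ 2 ℝ (V x) (W x)

theorem coords_apply {x : M} (s : SpinFrame S T x) (z : WithLp 2 (V x × W x)) :
    coords S T s z = inlEuc p q ((S.frame s.1).1.repr z.fst) +
      inrEuc p q ((T.frame s.2).1.repr z.snd) := rfl

theorem norm_coords {x : M} (s : SpinFrame S T x) (z : WithLp 2 (V x × W x)) :
    ‖coords S T s z‖ = ‖z‖ := by
  have h : ‖coords S T s z‖ ^ 2 = ‖z‖ ^ 2 := by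
    rw [coords_apply, norm_add_sq_real, inner_inl_inr, norm_inlEuc, norm_inrEuc,
      WithLp.prod_norm_sq_eq_of_L2]
    simp
  exact (sq_eq_sq₀ (norm_nonneg _) (norm_nonneg _)).mp h

variable (V W) in
/-- The fibre at `x` of the Clifford bundle `Cl(V ⊕ W)`. -/
abbrev CliffFiber (x : M) := CliffordAlgebra (negSq (WithLp 2 (V x × W x)))

/-- The component `[η] ∈ Cl_(p+q)` of `η ∈ Cl(V ⊕ W)` in a spinorial frame. -/
def cliffCoords {x : M} (s : SpinFrame S T x) : CliffFiber V W x →ₐ[ℝ] Cl (p + q) :=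
  map (isom (coords S T s) (norm_coords S T s))

theorem cliffCoords_act {x : M} (s : SpinFrame S T x) (g : Spin p) (h : Spin q)
    (η : CliffFiber V W x) :
    spinMul g h * cliffCoords S T (S.act s.1 g, T.act s.2 h) η =
      cliffCoords S T s η * spinMul g h := by
  induction η using CliffordAlgebra.induction with
  | algebraMap r => simp [Algebra.commutes]
  | ι z =>
    have e : ∀ r : SpinFrame S T x, cliffCoords S T r (ι _ z) =
        clInl p q (vec p ((S.frame r.1).1.repr z.fst)) +
          clInr p q (vec q ((T.frame r.2).1.repr z.snd)) := fun r => by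
      rw [clInl_vec, clInr_vec, ← map_add, ← coords_apply]
      exact map_apply_ι _ _
    have h1 := congrArg (clInl p q) (S.vec_repr_act s.1 g z.fst)
    have h2 := congrArg (clInr p q) (T.vec_repr_act s.2 h z.snd)
    rw [map_mul, map_mul] at h1 h2
    rw [e, e, spinMul, mul_add, add_mul]
    congr 1
    · rw [mul_assoc, clInl_vec, ← (commute_clInr_vec _ h).eq, ← mul_assoc, ← clInl_vec, h1,
        mul_assoc]
    · rw [mul_assoc, h2, ← mul_assoc, clInr_vec, (commute_clInl_vec g _).eq, mul_assoc]
  | mul a b ha hb =>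
    rw [map_mul, map_mul, ← mul_assoc, ha, mul_assoc, hb, mul_assoc]
  | add a b ha hb => rw [map_add, map_add, mul_add, ha, hb, add_mul]

/-- The Clifford action `η · φ` of `Cl(V ⊕ W)` on `Σ`: `[η · φ] = [η] [φ]`. -/
def cliffAct {x : M} (η : CliffFiber V W x) (φ : SpinorFiber S T x) : SpinorFiber S T x :=
  ⟨fun s => cliffCoords S T s η * φ.1 s, by
    intro s g h
    rw [← mul_assoc, cliffCoords_act, mul_assoc, φ.2 s g h]⟩

variable (V W) in
/-- A vector of `V x`, as an element of `Cl(V ⊕ W)`. -/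
def leftVec {x : M} (v : V x) : CliffFiber V W x := ι _ (WithLp.toLp 2 (v, 0))

variable (V W) in
/-- A vector of `W x`, as an element of `Cl(V ⊕ W)`. -/
def rightVec {x : M} (w : W x) : CliffFiber V W x := ι _ (WithLp.toLp 2 (0, w))

variable (W) in
/-- The volume element `ω ∈ Cl(V x) ⊂ Cl(V x ⊕ W x)`: the product of the vectors of a positively
oriented orthonormal basis of `V x`. -/
def volumeElement (o : BundleOrientation I F V p) (x : M) : CliffFiber V W x :=
  (List.ofFn fun i => leftVec V W (somePosFrame o x i)).prod

/-- `ω` does not depend on the positively oriented orthonormal basis. -/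
theorem volumeElement_eq (o : BundleOrientation I F V p) {x : M}
    (b : OrthonormalBasis (Fin p) ℝ (V x)) (hb : b.toBasis.orientation = o.or x) :
    volumeElement W o x = (List.ofFn fun i => leftVec V W (b i)).prod := by
  have hl : ∀ v : V x, ‖(WithLp.linearEquiv 2 ℝ (V x × W x)).symm.toLinearMap.comp
      (LinearMap.inl ℝ (V x) (W x)) v‖ = ‖v‖ := fun v => by
    simp
  have key : ∀ c : OrthonormalBasis (Fin p) ℝ (V x),
      (List.ofFn fun i => leftVec V W (c i)).prod = map (isom _ hl) (cliffProd c) := fun c => by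
    rw [cliffProd, map_list_prod, List.map_ofFn]
    congr 2
    funext i
    exact (map_apply_ι (isom _ hl) (c i)).symm
  rw [volumeElement, key, key, cliffProd_eq_of_orientation_eq (somePosFrame o x) b
    ((Classical.arbitrary (PosFrame o x)).2.trans hb.symm)]

/-- The map `χ : UΣ → M × Cl_(p+q)`, `ψ ∈ UΣ_x ↦ (x, ⟪⟪ω · ψ, ψ⟫⟫)`. -/
def chi (ψ : Σ x, USigma S T x) : M × Cl (p + q) :=
  (ψ.1, pairing S T (cliffAct S T (volumeElement W o ψ.1) ψ.2.1) ψ.2.1)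

/-- The covariant derivative `∇` on `Σ` associated with the spinorial connections induced by the
connections `cov` on `V` and `cov'` on `W`: for a section `φ` with component `[φ]` in a smooth local
spinorial frame `s̃`, the component of `∇_X φ` in `s̃` is `∂_X [φ] + (s̃^*α)(X) · [φ]`. -/
def nabla (cov : CovariantDerivative I F V) (cov' : CovariantDerivative I G W)
    (φ : ∀ x, SpinorFiber S T x) (x : M) (X : TangentSpace I x) : SpinorFiber S T x :=
  spinorOfFrame S T (S.localSection x x, T.localSection x x)
    (mvfderiv I (fun y => (φ y).1 (S.localSection x y, T.localSection x y)) x X +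
      (clInl p q (S.connForm cov (S.localSection x) x X) +
        clInr p q (T.connForm cov' (T.localSection x) x X)) *
        (φ x).1 (S.localSection x x, T.localSection x x))

/-- `∑_j e_j · B(X, e_j) ∈ Cl(V ⊕ W)` for a bilinear map `B : V x × V x → W x`, with
`(e_1, …, e_p)` an orthonormal basis of `V x`. -/
def bilinTerm (o : BundleOrientation I F V p) {x : M} (b : V x →ₗ[ℝ] V x →ₗ[ℝ] W x) (X : V x) :
    CliffFiber V W x :=
  ∑ j, leftVec V W (somePosFrame o x j) * rightVec V W (b X (somePosFrame o x j))

/-- `∑_j e_j · B(X, e_j)` does not depend on the orthonormal basis. -/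
theorem bilinTerm_eq (o : BundleOrientation I F V p) {x : M} (b : V x →ₗ[ℝ] V x →ₗ[ℝ] W x)
    (X : V x) (e : OrthonormalBasis (Fin p) ℝ (V x)) :
    bilinTerm o b X = ∑ j, leftVec V W (e j) * rightVec V W (b X (e j)) := by
  let l : V x →ₗ[ℝ] CliffFiber V W x := ι _ ∘ₗ
    (WithLp.linearEquiv 2 ℝ (V x × W x)).symm.toLinearMap ∘ₗ LinearMap.inl ℝ (V x) (W x)
  let r : W x →ₗ[ℝ] CliffFiber V W x := ι _ ∘ₗ
    (WithLp.linearEquiv 2 ℝ (V x × W x)).symm.toLinearMap ∘ₗ LinearMap.inr ℝ (V x) (W x)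
  exact sum_bilin_eq ((LinearMap.mul ℝ (CliffFiber V W x)).compl₁₂ l (r ∘ₗ b X))
    (somePosFrame o x) e

end Sigma

/-! ### Submanifolds of `ℝ^(p+q)` -/

section Immersion

variable {p q : ℕ} {M : Type*} [TopologicalSpace M] [ChartedSpace (Euc p) M]
  [IsManifold (𝓡 p) ∞ M] [RiemannianBundle (fun x : M => TangentSpace (𝓡 p) x)]
  {E : M → Type*} [TopologicalSpace (TotalSpace (Euc q) E)] [∀ x, NormedAddCommGroup (E x)]
  [∀ x, InnerProductSpace ℝ (E x)] [FiberBundle (Euc q) E]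
  {oM : BundleOrientation (𝓡 p) (Euc p) (fun x : M => TangentSpace (𝓡 p) x) p}
  {oE : BundleOrientation (𝓡 p) (Euc q) E q}
  (S : SpinStructure oM) (T : SpinStructure oE)

/-- `cov` is the Levi-Civita connection of `M`: it is metric and torsion-free. -/
def IsLeviCivita
    [IsContMDiffRiemannianBundle (𝓡 p) ∞ (Euc p) (fun x : M => TangentSpace (𝓡 p) x)]
    (cov : CovariantDerivative (𝓡 p) (Euc p) (fun x : M => TangentSpace (𝓡 p) x)) : Prop :=
  haveI : IsContMDiffRiemannianBundle (𝓡 p) 1 (Euc p) (fun x : M => TangentSpace (𝓡 p) x) :=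
    IsContMDiffRiemannianBundle.of_le (n := ∞) (by norm_cast)
  cov.IsMetricCompatible ∧ cov.torsion = 0

/-- The form `ξ(X) = ⟪⟪X · φ, φ⟫⟫`. -/
def xi (φ : ∀ x, SpinorFiber S T x) (x : M) (X : TangentSpace (𝓡 p) x) : Cl (p + q) :=
  pairing S T (cliffAct S T (leftVec (fun x : M => TangentSpace (𝓡 p) x) E X) (φ x)) (φ x)

/-- The connection `∇'_X φ = ∇_X φ + ½ ∑_j e_j · B(X, e_j) · φ`. -/
def nablaPrime
    (covM : CovariantDerivative (𝓡 p) (Euc p) (fun x : M => TangentSpace (𝓡 p) x))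
    (covE : CovariantDerivative (𝓡 p) (Euc q) E)
    (b : ∀ x : M, TangentSpace (𝓡 p) x →ₗ[ℝ] TangentSpace (𝓡 p) x →ₗ[ℝ] E x)
    (φ : ∀ x, SpinorFiber S T x) (x : M) (X : TangentSpace (𝓡 p) x) : SpinorFiber S T x :=
  nabla S T covM covE φ x X +
    (1 / 2 : ℝ) • cliffAct S T
      (bilinTerm (V := fun x : M => TangentSpace (𝓡 p) x) oM (b x) X) (φ x)

/-- The Gauss map `x ↦ dF(e_1) · dF(e_2) ⋯ dF(e_p) ∈ Cl_n`, where `(e_1, …, e_p)` is a positively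
oriented orthonormal basis of `T_x M`. -/
def gaussMap (oM : BundleOrientation (𝓡 p) (Euc p) (fun x : M => TangentSpace (𝓡 p) x) p) {n : ℕ}
    (F : M → Euc n) (x : M) : Cl n :=
  cliffProd fun i => mvfderiv (𝓡 p) F x (somePosFrame oM x i)

/-- When `dF_x` is isometric, the Gauss map at `x` does not depend on the positively oriented
orthonormal basis. -/
theorem gaussMap_eq (oM : BundleOrientation (𝓡 p) (Euc p) (fun x : M => TangentSpace (𝓡 p) x) p)
    {n : ℕ} (F : M → Euc n) (x : M)
    (hF : ∀ X : TangentSpace (𝓡 p) x, ‖mvfderiv (𝓡 p) F x X‖ = ‖X‖)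
    (b : OrthonormalBasis (Fin p) ℝ (TangentSpace (𝓡 p) x))
    (hb : b.toBasis.orientation = oM.or x) :
    gaussMap oM F x = cliffProd fun i => mvfderiv (𝓡 p) F x (b i) := by
  have key : ∀ c : OrthonormalBasis (Fin p) ℝ (TangentSpace (𝓡 p) x),
      (cliffProd fun i => mvfderiv (𝓡 p) F x (c i)) =
        map (isom (mvfderiv (𝓡 p) F x).toLinearMap hF) (cliffProd c) := fun c => by
    rw [cliffProd, cliffProd, map_list_prod, List.map_ofFn]
    congr 2
    funext i
    exact (map_apply_ι (isom (mvfderiv (𝓡 p) F x).toLinearMap hF) (c i)).symm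
  rw [gaussMap, key, key, cliffProd_eq_of_orientation_eq (somePosFrame oM x) b
    ((Classical.arbitrary (PosFrame oM x)).2.trans hb.symm)]

end Immersion

end SpinSubmanifold

end


open SpinSubmanifold

/-!
Everything takes place in one fibre. In a spinorial frame, `⟪⟪η · ψ, ψ⟫⟫` for `η ∈ Cl(V ⊕ W)` and
`ψ ∈ UΣ` is `τ(g) [η] g` with `g = [ψ] ∈ Spin(n)`. As `τ(g) = g⁻¹`, the map `a ↦ τ(g) a g` is an
algebra automorphism of `Cl_n`; it preserves `ℝⁿ`, hence also the quadratic form, and so it is the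
automorphism induced by a linear isometry of `ℝⁿ` (`exists_isometry_map_eq_spin_conj`). Composing it
with the isometric coordinates `V ⊕ W → ℝⁿ` shows that `η ↦ ⟪⟪η · ψ, ψ⟫⟫` is the algebra
homomorphism induced by an isometric map `L : V ⊕ W → ℝⁿ` (`exists_isometry_map_eq_pairing`).

For `η = X` this identifies `dF(X)` with `L X`, so `F` is isometric and the Gauss map is a product
of orthonormal vectors. For `η = ω`, multiplicativity gives `⟪⟪ω · ψ, ψ⟫⟫ = L e_1 ⋯ L e_p`, so `χ`
takes values in the Grassmannian, and for `ψ = φ` this product is the Gauss map.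

Finally, in the spinorial frame with which `∇` is computed at `x`, `∇'` is `∂_X + A(X)`, with `A(X)`
the sum of the two spinorial connection forms and of half of the coordinates of `∑ e_j · B(X, e_j)`.
All of these are combinations of products of two orthogonal vectors, because `e_j` is tangent and
`B(X, e_j)` is normal. That `φ` is parallel for `∇'` is the Killing equation.
-/

namespace SpinSubmanifold

/-! ### Conjugation by elements of `Spin(n)` -/

theorem vec_mul_vec_self {n : ℕ} (v : Euc n) :
    vec n v * vec n v = algebraMap ℝ (Cl n) (-(‖v‖ ^ 2)) := by
  rw [ι_sq_scalar, negSq_apply]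

theorem algebraMap_Cl_injective (n : ℕ) : Function.Injective (algebraMap ℝ (Cl n)) :=
  haveI : Nontrivial (Cl n) := (equivExterior (negSq (Euc n))).toEquiv.nontrivial
  (algebraMap ℝ (Cl n)).injective

/-- Conjugation of `Cl_n` by `g ∈ Spin(n)` is induced by a linear isometry of `ℝⁿ`, since `τ(g)` is
the inverse of `g`, and since conjugation preserves `ℝⁿ` and squares of vectors. -/
theorem exists_isometry_map_eq_spin_conj {n : ℕ} {g : Cl n} (hg : g ∈ Spin n) :
    ∃ (A : Euc n →ₗ[ℝ] Euc n) (hA : ∀ v, ‖A v‖ = ‖v‖),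
      ∀ a, map (isom A hA) a = reverse g * a * g := by
  have hinv := self_mul_reverse_of_spin hg
  have hinv' := reverse_mul_self_of_spin hg
  have hrange : ∀ v, ∃ w, vec n w = reverse g * vec n v * g := by
    intro v
    let u : (Cl n)ˣ := ⟨reverse g, g, hinv', hinv⟩
    have hu : (u : Cl n) ∈ Spin n := by
      have := spinGroup.star_mem hg
      rwa [star_def, spinGroup.involute_eq hg] at this
    obtain ⟨w, hw⟩ := spinGroup.conjAct_smul_ι_mem_range_ι hu v
    exact ⟨w, hw⟩
  choose f hf using hrange
  let A : Euc n →ₗ[ℝ] Euc n :=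
    { toFun := f
      map_add' := fun v w => vec_injective n (by
        rw [map_add, hf, hf, hf, map_add, mul_add, add_mul])
      map_smul' := fun c v => vec_injective n (by
        rw [map_smul, hf, hf, map_smul, mul_smul_comm, smul_mul_assoc, RingHom.id_apply]) }
  have hA : ∀ v, ‖A v‖ = ‖v‖ := by
    intro v
    have h : vec n (A v) * vec n (A v) = vec n v * vec n v := by
      change vec n (f v) * vec n (f v) = _
      calc vec n (f v) * vec n (f v)
          = reverse g * vec n v * (g * reverse g) * vec n v * g := by
            rw [hf]; simp only [mul_assoc]
        _ = reverse g * (vec n v * vec n v) * g := by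
            rw [hinv, mul_one]; simp only [mul_assoc]
        _ = vec n v * vec n v := by
            rw [vec_mul_vec_self, ← Algebra.commutes, mul_assoc, hinv', mul_one]
    rw [vec_mul_vec_self, vec_mul_vec_self] at h
    have h' := neg_injective (algebraMap_Cl_injective n h)
    exact (sq_eq_sq₀ (norm_nonneg _) (norm_nonneg _)).mp h'
  refine ⟨A, hA, fun a => ?_⟩
  induction a using CliffordAlgebra.induction with
  | algebraMap r => rw [AlgHom.commutes, ← Algebra.commutes, mul_assoc, hinv', mul_one]
  | ι v =>
    rw [map_apply_ι]
    exact hf v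
  | mul a b ha hb =>
    rw [map_mul, ha, hb]
    calc reverse g * a * g * (reverse g * b * g)
        = reverse g * a * (g * reverse g) * b * g := by simp only [mul_assoc]
      _ = reverse g * (a * b) * g := by rw [hinv, mul_one]; simp only [mul_assoc]
  | add a b ha hb => rw [map_add, ha, hb, mul_add, add_mul]

theorem inner_map_map_of_norm_map {V W : Type*} [NormedAddCommGroup V] [InnerProductSpace ℝ V]
    [NormedAddCommGroup W] [InnerProductSpace ℝ W] (f : V →ₗ[ℝ] W) (hf : ∀ v, ‖f v‖ = ‖v‖)
    (v w : V) : inner ℝ (f v) (f w) = inner ℝ v w :=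
  LinearIsometry.inner_map_map ⟨f, hf⟩ v w

theorem cliffProd_mem_orientedGrassmannian {V : Type*} [NormedAddCommGroup V]
    [InnerProductSpace ℝ V] {p n : ℕ} (f : V →ₗ[ℝ] Euc n) (hf : ∀ v, ‖f v‖ = ‖v‖)
    {e : Fin p → V} (he : Orthonormal ℝ e) :
    cliffProd (fun i => f (e i)) ∈ orientedGrassmannian p n :=
  ⟨_, he.comp_linearIsometry ⟨f, hf⟩, rfl⟩

/-- The isometric inclusion of the first summand of an orthogonal sum. -/
def leftIncl (V W : Type*) [NormedAddCommGroup V] [InnerProductSpace ℝ V]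
    [NormedAddCommGroup W] [InnerProductSpace ℝ W] : V →ₗ[ℝ] WithLp 2 (V × W) :=
  (WithLp.linearEquiv 2 ℝ (V × W)).symm.toLinearMap ∘ₗ LinearMap.inl ℝ V W

theorem norm_leftIncl {V W : Type*} [NormedAddCommGroup V] [InnerProductSpace ℝ V]
    [NormedAddCommGroup W] [InnerProductSpace ℝ W] (v : V) : ‖leftIncl V W v‖ = ‖v‖ := by
  simp [leftIncl]

/-! ### The pairing of a unit spinor with itself -/

section Pairing

variable {B : Type*} [NormedAddCommGroup B] [NormedSpace ℝ B] {H : Type*} [TopologicalSpace H]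
  {I : ModelWithCorners ℝ B H} {M : Type*} [TopologicalSpace M] [ChartedSpace H M]
  {F : Type*} [NormedAddCommGroup F] [NormedSpace ℝ F]
  {V : M → Type*} [TopologicalSpace (TotalSpace F V)] [∀ x, NormedAddCommGroup (V x)]
  [∀ x, InnerProductSpace ℝ (V x)] [FiberBundle F V] {p : ℕ}
  {G : Type*} [NormedAddCommGroup G] [NormedSpace ℝ G]
  {W : M → Type*} [TopologicalSpace (TotalSpace G W)] [∀ x, NormedAddCommGroup (W x)]
  [∀ x, InnerProductSpace ℝ (W x)] [FiberBundle G W] {q : ℕ}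
  {o : BundleOrientation I F V p} {o' : BundleOrientation I G W q}
  (S : SpinStructure o) (T : SpinStructure o')

/-- For `ψ ∈ UΣ_x`, the map `η ↦ ⟪⟪η · ψ, ψ⟫⟫` is the algebra homomorphism
`Cl(V x ⊕ W x) → Cl_(p+q)` induced by an isometric linear map. -/
theorem exists_isometry_map_eq_pairing {x : M} {ψ : SpinorFiber S T x} (hψ : ψ ∈ USigma S T x) :
    ∃ (L : WithLp 2 (V x × W x) →ₗ[ℝ] Euc (p + q)) (hL : ∀ z, ‖L z‖ = ‖z‖),
      ∀ η, pairing S T (cliffAct S T η ψ) ψ = map (isom L hL) η := by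
  let s : SpinFrame S T x := Classical.arbitrary _
  obtain ⟨A, hA, h⟩ := exists_isometry_map_eq_spin_conj (hψ s)
  refine ⟨A ∘ₗ coords S T s, fun z => by rw [LinearMap.comp_apply, hA, norm_coords],
    fun η => ?_⟩
  rw [pairing_eq S T _ _ s]
  change reverse (ψ.1 s) * (cliffCoords S T s η * ψ.1 s) = _
  rw [← mul_assoc, ← h, cliffCoords, ← AlgHom.comp_apply, map_comp_map]
  rfl

/-- The restriction of `exists_isometry_map_eq_pairing` to the first summand, evaluated on vectors
and on the volume element. -/
theorem exists_isometry_pairing_leftVec {x : M} {ψ : SpinorFiber S T x}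
    (hψ : ψ ∈ USigma S T x) :
    ∃ L : V x →ₗ[ℝ] Euc (p + q), (∀ v, ‖L v‖ = ‖v‖) ∧
      (∀ v, pairing S T (cliffAct S T (leftVec V W v) ψ) ψ = vec (p + q) (L v)) ∧
      pairing S T (cliffAct S T (volumeElement W o x) ψ) ψ =
        cliffProd fun i => L (somePosFrame o x i) := by
  obtain ⟨L, hL, h⟩ := exists_isometry_map_eq_pairing S T hψ
  have hv : ∀ v, map (isom L hL) (leftVec V W v) = vec (p + q) (L (leftIncl (V x) (W x) v)) :=
    fun v => map_apply_ι _ _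
  refine ⟨L ∘ₗ leftIncl (V x) (W x), fun v => by rw [LinearMap.comp_apply, hL, norm_leftIncl],
    fun v => by rw [h, hv]; rfl, ?_⟩
  rw [h, volumeElement, map_list_prod, List.map_ofFn, cliffProd]
  congr 2
  funext i
  exact hv _

/-! ### The connection form of `∇'` -/

theorem map_mem_spinLie {k n : ℕ} (f : Euc k →ₗ[ℝ] Euc n) (hf : ∀ v, ‖f v‖ = ‖v‖) {a : Cl k}
    (ha : a ∈ spinLie k) : map (isom f hf) a ∈ spinLie n := by
  induction ha using Submodule.span_induction with
  | mem a ha =>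
    obtain ⟨v, w, hvw, rfl⟩ := ha
    rw [map_mul, map_apply_ι, map_apply_ι]
    exact Submodule.subset_span ⟨f v, f w, by rw [inner_map_map_of_norm_map f hf, hvw], rfl⟩
  | zero => rw [map_zero]; exact zero_mem _
  | add a b _ _ ha hb => rw [map_add]; exact add_mem ha hb
  | smul c a _ ha => rw [map_smul]; exact Submodule.smul_mem _ _ ha

theorem connForm_mem_spinLie (cov : CovariantDerivative I F V) (s : ∀ x, S.P x) (x : M)
    (X : TangentSpace I x) : S.connForm cov s x X ∈ spinLie p := by
  refine Submodule.smul_mem _ _ (Submodule.sum_mem _ fun i _ => Submodule.sum_mem _ fun j hj =>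
    Submodule.smul_mem _ _ (Submodule.subset_span ⟨_, _, ?_, rfl⟩))
  have hij : j ≠ i := (Finset.mem_Ioi.mp hj).ne'
  simp [EuclideanSpace.inner_single_left, hij.symm]

theorem connForm_add (cov : CovariantDerivative I F V) (s : ∀ x, S.P x) (x : M)
    (X Y : TangentSpace I x) :
    S.connForm cov s x (X + Y) = S.connForm cov s x X + S.connForm cov s x Y := by
  simp only [SpinStructure.connForm, map_add, inner_add_left, add_smul, Finset.sum_add_distrib,
    smul_add]

theorem connForm_smul (cov : CovariantDerivative I F V) (s : ∀ x, S.P x) (x : M) (c : ℝ)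
    (X : TangentSpace I x) : S.connForm cov s x (c • X) = c • S.connForm cov s x X := by
  simp only [SpinStructure.connForm, map_smul, real_inner_smul_left, mul_smul, Finset.smul_sum]
  simp only [smul_comm c]

theorem bilinTerm_add (o : BundleOrientation I F V p) {x : M} (b : V x →ₗ[ℝ] V x →ₗ[ℝ] W x)
    (X Y : V x) : bilinTerm o b (X + Y) = bilinTerm o b X + bilinTerm o b Y := by
  simp only [bilinTerm, ← Finset.sum_add_distrib, ← mul_add]
  refine Finset.sum_congr rfl fun j _ => congrArg _ ?_
  rw [rightVec, rightVec, rightVec, ← map_add, map_add, LinearMap.add_apply, ← WithLp.toLp_add,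
    Prod.mk_add_mk, add_zero]

theorem bilinTerm_smul (o : BundleOrientation I F V p) {x : M} (b : V x →ₗ[ℝ] V x →ₗ[ℝ] W x)
    (c : ℝ) (X : V x) : bilinTerm o b (c • X) = c • bilinTerm o b X := by
  simp only [bilinTerm, Finset.smul_sum, ← mul_smul_comm]
  refine Finset.sum_congr rfl fun j _ => congrArg _ ?_
  rw [rightVec, rightVec, ← map_smul, map_smul, LinearMap.smul_apply, ← WithLp.toLp_smul,
    Prod.smul_mk, smul_zero]

theorem cliffCoords_bilinTerm_mem_spinLie {x : M} (s : SpinFrame S T x)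
    (b : V x →ₗ[ℝ] V x →ₗ[ℝ] W x) (X : V x) :
    cliffCoords S T s (bilinTerm o b X) ∈ spinLie (p + q) := by
  rw [bilinTerm, map_sum]
  refine Submodule.sum_mem _ fun j _ => ?_
  rw [map_mul, leftVec, rightVec, cliffCoords, map_apply_ι, map_apply_ι]
  refine Submodule.subset_span ⟨_, _, ?_, rfl⟩
  refine (inner_map_map_of_norm_map (coords S T s) (norm_coords S T s) _ _).trans ?_
  simp [WithLp.prod_inner_apply]

end Pairing

section Connection

variable {p q : ℕ} {M : Type*} [TopologicalSpace M] [ChartedSpace (Euc p) M]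
  [IsManifold (𝓡 p) ∞ M] [RiemannianBundle (fun x : M => TangentSpace (𝓡 p) x)]
  {E : M → Type*} [TopologicalSpace (TotalSpace (Euc q) E)] [∀ x, NormedAddCommGroup (E x)]
  [∀ x, InnerProductSpace ℝ (E x)] [FiberBundle (Euc q) E]
  {oM : BundleOrientation (𝓡 p) (Euc p) (fun x : M => TangentSpace (𝓡 p) x) p}
  {oE : BundleOrientation (𝓡 p) (Euc q) E q}
  (S : SpinStructure oM) (T : SpinStructure oE)

/-- The local form at `x` of `∇'`, in the spinorial frame in which `∇` is computed at `x`. -/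
noncomputable def connFormPrime (covM : CovariantDerivative (𝓡 p) (Euc p) (fun x : M => TangentSpace (𝓡 p) x))
    (covE : CovariantDerivative (𝓡 p) (Euc q) E) (x : M)
    (b : TangentSpace (𝓡 p) x →ₗ[ℝ] TangentSpace (𝓡 p) x →ₗ[ℝ] E x) :
    TangentSpace (𝓡 p) x →ₗ[ℝ] spinLie (p + q) where
  toFun X := ⟨clInl p q (S.connForm covM (S.localSection x) x X) +
      clInr p q (T.connForm covE (T.localSection x) x X) +
      (1 / 2 : ℝ) • cliffCoords S T (S.localSection x x, T.localSection x x)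
        (bilinTerm (V := fun x : M => TangentSpace (𝓡 p) x) oM b X),
    add_mem (add_mem (map_mem_spinLie _ _ (connForm_mem_spinLie S covM _ x X))
      (map_mem_spinLie _ _ (connForm_mem_spinLie T covE _ x X)))
      (Submodule.smul_mem _ _ (cliffCoords_bilinTerm_mem_spinLie S T _ b X))⟩
  map_add' X Y := by
    ext1
    simp only [Submodule.coe_add, connForm_add, map_add, bilinTerm_add, smul_add]
    abel
  map_smul' c X := by
    ext1
    simp only [Submodule.coe_smul, connForm_smul, map_smul, bilinTerm_smul, smul_add,
      RingHom.id_apply, smul_comm c (1 / 2 : ℝ)]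

theorem nablaPrime_apply_localSection
    (covM : CovariantDerivative (𝓡 p) (Euc p) (fun x : M => TangentSpace (𝓡 p) x))
    (covE : CovariantDerivative (𝓡 p) (Euc q) E)
    (b : ∀ x : M, TangentSpace (𝓡 p) x →ₗ[ℝ] TangentSpace (𝓡 p) x →ₗ[ℝ] E x)
    (ψ : ∀ x, SpinorFiber S T x) (x : M) (X : TangentSpace (𝓡 p) x) :
    (nablaPrime S T covM covE b ψ x X).1 (S.localSection x x, T.localSection x x) =
      mvfderiv (𝓡 p) (fun y => (ψ y).1 (S.localSection x y, T.localSection x y)) x X +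
        (connFormPrime S T covM covE x (b x) X : Cl (p + q)) *
          (ψ x).1 (S.localSection x x, T.localSection x x) := by
  change (nabla S T covM covE ψ x X).1 _ + (1 / 2 : ℝ) • (cliffCoords S T _ _ * _) = _
  rw [nabla, spinorOfFrame_apply, add_assoc, ← smul_mul_assoc, ← add_mul]
  rfl

end Connection

theorem SpinStructure.IsSection.mono {B : Type*} [NormedAddCommGroup B] [NormedSpace ℝ B]
    {H : Type*} [TopologicalSpace H] {I : ModelWithCorners ℝ B H} {M : Type*} [TopologicalSpace M]
    [ChartedSpace H M] {F : Type*} [NormedAddCommGroup F] [NormedSpace ℝ F] {V : M → Type*}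
    [TopologicalSpace (TotalSpace F V)] [∀ x, NormedAddCommGroup (V x)]
    [∀ x, InnerProductSpace ℝ (V x)] [FiberBundle F V] {k : ℕ} {o : BundleOrientation I F V k}
    {S : SpinStructure o} {U U' : Set M} {s : ∀ x, S.P x} (h : S.IsSection U s) (hU : U' ⊆ U) :
    S.IsSection U' s := by
  let _ := S.top
  exact ⟨ContinuousOn.mono h.1 hU, fun i => (h.2 i).mono hU⟩

end SpinSubmanifold

theorem mainTheorem7 {p q : ℕ} {M : Type*} [TopologicalSpace M] [ChartedSpace (Euc p) M]
    [IsManifold (𝓡 p) ∞ M] [RiemannianBundle (fun x : M => TangentSpace (𝓡 p) x)]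
    [IsContMDiffRiemannianBundle (𝓡 p) ∞ (Euc p) (fun x : M => TangentSpace (𝓡 p) x)]
    {E : M → Type*} [TopologicalSpace (TotalSpace (Euc q) E)] [∀ x, NormedAddCommGroup (E x)]
    [∀ x, InnerProductSpace ℝ (E x)] [FiberBundle (Euc q) E] [VectorBundle ℝ (Euc q) E]
    [ContMDiffVectorBundle ∞ (Euc q) E (𝓡 p)] [IsContMDiffRiemannianBundle (𝓡 p) ∞ (Euc q) E]
    (oM : BundleOrientation (𝓡 p) (Euc p) (fun x : M => TangentSpace (𝓡 p) x) p)
    (oE : BundleOrientation (𝓡 p) (Euc q) E q)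
    (S : SpinStructure oM) (T : SpinStructure oE)
    -- the Levi-Civita connection of `M` and the connection of `E`
    (covM : CovariantDerivative (𝓡 p) (Euc p) (fun x : M => TangentSpace (𝓡 p) x))
    (hcovM : IsLeviCivita covM)
    (covE : CovariantDerivative (𝓡 p) (Euc q) E) [CovariantDerivative.ContMDiffCovariantDerivative covE ∞]
    (hcovE : covE.IsMetricCompatible)
    (B : ∀ x : M, TangentSpace (𝓡 p) x →ₗ[ℝ] TangentSpace (𝓡 p) x →ₗ[ℝ] E x)
    (hB : ∀ (x : M) (X Y : TangentSpace (𝓡 p) x), B x X Y = B x Y X)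
    -- a smooth section `φ` of `UΣ` which solves the Killing equation
    (φ : ∀ x, SpinorFiber S T x) (hφ : IsSmoothSection S T φ) (hφU : ∀ x, φ x ∈ USigma S T x)
    (hKilling : ∀ (x : M) (X : TangentSpace (𝓡 p) x), nabla S T covM covE φ x X =
      -((1 / 2 : ℝ) • cliffAct S T
        (bilinTerm (V := fun x : M => TangentSpace (𝓡 p) x) oM (B x) X) (φ x)))
    -- the immersion given by `φ`, that is `dF = ξ`
    (F : M → Euc (p + q)) (hF : ContMDiff (𝓡 p) 𝓘(ℝ, Euc (p + q)) ∞ F)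
    (hFξ : ∀ (x : M) (X : TangentSpace (𝓡 p) x),
      vec (p + q) (mvfderiv (𝓡 p) F x X) = xi S T φ x X) :
    -- `F` is isometric and its Gauss map takes values in the Grassmannian
    (∀ (x : M) (X : TangentSpace (𝓡 p) x), ‖mvfderiv (𝓡 p) F x X‖ = ‖X‖) ∧
    (∀ x, gaussMap oM F x ∈ orientedGrassmannian p (p + q)) ∧
    -- `χ` maps `UΣ` to `M × 𝒬_o` and `χ ∘ φ = (id, G)`
    (∀ ψ : Σ x, USigma S T x, (chi S T ψ).2 ∈ orientedGrassmannian p (p + q)) ∧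
    (∀ x, chi S T ⟨x, φ x, hφU x⟩ = (x, gaussMap oM F x)) ∧
    -- `∇'` is a connection on `UΣ`: in spinorial frames it is `d + A` with `A ∈ spin(p + q)`
    (∀ x : M, ∃ (U : Set M) (s : ∀ y, S.P y) (t : ∀ y, T.P y),
      IsOpen U ∧ x ∈ U ∧ S.IsSection U s ∧ T.IsSection U t ∧
      ∃ A : TangentSpace (𝓡 p) x →ₗ[ℝ] spinLie (p + q),
        ∀ ψ : ∀ y, SpinorFiber S T y, IsSmoothSection S T ψ → ∀ X : TangentSpace (𝓡 p) x,
          (nablaPrime S T covM covE B ψ x X).1 (s x, t x) =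
            mvfderiv (𝓡 p) (fun y => (ψ y).1 (s y, t y)) x X +
              (A X : Cl (p + q)) * (ψ x).1 (s x, t x)) ∧
    -- `φ` is parallel for `∇'`
    (∀ (x : M) (X : TangentSpace (𝓡 p) x), nablaPrime S T covM covE B φ x X = 0) := by
  have key : ∀ x, ∃ L : TangentSpace (𝓡 p) x →ₗ[ℝ] Euc (p + q), (∀ v, ‖L v‖ = ‖v‖) ∧
      (∀ v, mvfderiv (𝓡 p) F x v = L v) ∧
      pairing S T (cliffAct S T (volumeElement E oM x) (φ x)) (φ x) = gaussMap oM F x := by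
    intro x
    obtain ⟨L, hL, hv, hω⟩ := exists_isometry_pairing_leftVec S T (hφU x)
    have hFL : ∀ v, mvfderiv (𝓡 p) F x v = L v := fun v =>
      vec_injective _ ((hFξ x v).trans (hv v))
    refine ⟨L, hL, hFL, hω.trans ?_⟩
    simp only [gaussMap, hFL]
  refine ⟨fun x X => ?_, fun x => ?_, fun ψ => ?_, fun x => ?_, fun x => ?_, fun x X => ?_⟩
  · obtain ⟨L, hL, hFL, -⟩ := key x
    rw [hFL, hL]
  · obtain ⟨L, hL, hFL, -⟩ := key x
    simp only [gaussMap, hFL]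
    exact cliffProd_mem_orientedGrassmannian L hL (somePosFrame oM x).orthonormal
  · obtain ⟨L, hL, -, hω⟩ := exists_isometry_pairing_leftVec S T ψ.2.2
    change pairing S T _ _ ∈ _
    rw [hω]
    exact cliffProd_mem_orientedGrassmannian L hL (somePosFrame oM ψ.1).orthonormal
  · obtain ⟨-, -, -, h⟩ := key x
    exact Prod.ext rfl h
  · exact ⟨S.localDomain x ∩ T.localDomain x, S.localSection x, T.localSection x,
      (S.isOpen_localDomain x).inter (T.isOpen_localDomain x),
      ⟨S.mem_localDomain x, T.mem_localDomain x⟩,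
      (S.isSection_localSection x).mono Set.inter_subset_left,
      (T.isSection_localSection x).mono Set.inter_subset_right,
      connFormPrime S T covM covE x (B x),
      fun ψ _ X => nablaPrime_apply_localSection S T covM covE B ψ x X⟩
  · rw [nablaPrime, hKilling, neg_add_cancel]
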